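/- Let $M$ players have strategy spaces $\mathbb{R}^{d_1},\dots,\mathbb{R}^{d_M}$, put $n=d_1+\cdots+d_M$, and write joint strategies as $\omega=(\omega_1,\dots,\omega_M)\in\mathbb{R}^n$. All derivatives of utility functions below are weak derivatives. Let $C_0$ be the closure of $C^\infty(\mathbb{R}^n)\cap H^2(\mathbb{R}^n)$ in $H^2(\mathbb{R}^n)$ for the $H^2$-norm, and let $\tilde C_1=L^2(\mathbb{R}^n;\mathbb{R}^n)$ with inner product $\langle X,Y\rangle=\sum_{i=1}^n\int_{\mathbb{R}^n}X_iY_i\,dx$. Let $\tilde d_1:C_0\to\tilde C_1$, $\tilde d_1f=(\partial f/\partial x_1,\dots,\partial f/\partial x_n)$. For a game $u=(u_1,\dots,u_M)$ with $u_m\in C_0$ put $Du=(\nabla_{\omega_1}u_1,\dots,\nabla_{\omega_M}u_M)$, and define $$\tilde{\mathcal V}=\{u\in C_0^{\times M}: Du\neq0,\ Du\in\mathrm{im}(\tilde d_1)^\perp\}\cup\{0\},\qquad \tilde{\mathcal N}=\{u\in (C_0\cap C^\infty(\mathbb{R}^n))^{\times M}: Du=0\}.$$ Suppose that $u$ is a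 vector potential game, i.e. $u=v+w$ with $v\in\tilde{\mathcal V}$ and $w\in\tilde{\mathcal N}$, and that $Du$ is (represented almost everywhere by) a smooth vector field on $\mathbb{R}^n$, again denoted by $Du$. Suppose that orbits are bounded in the following sense: $\Omega\subset\mathbb{R}^n$ is a compact set such that for every $x\in\Omega$ the solution $t\mapsto\theta_t(x)$ of $$\dot x(t)=Du(x(t)),\qquad x(0)=x,$$ exists for all $t\ge0$ and satisfies $\theta_t(x)\in\Omega$ for all $t\ge 0$. Then the dynamics $\dot x=Du$ is Poincaré recurrent on $\Omega$: for Lebesgue-almost every $x\in\Omega$ there is a sequence of times $t_k\to\infty$ with $\theta_{t_k}(x)\to x$. That is, the trajectory returns arbitrarily close to its initial point infinitely often. -/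

import Mathlib

open MeasureTheory Filter Topology
open scoped ContDiff

namespace DiffGame

/-- The classical partial derivative of `φ` along the coordinate `i`. -/
noncomputable def partialDeriv {ι : Type*} [Fintype ι] [DecidableEq ι] (i : ι)
    (φ : EuclideanSpace ℝ ι → ℝ) : EuclideanSpace ℝ ι → ℝ :=
  fun x => fderiv ℝ φ x (EuclideanSpace.single i 1)

/-- The iterated partial derivative along a list of coordinates; a list of length `k` stands for
a multi-index of order `k`. -/
noncomputable def iterPartialDeriv {ι : Type*} [Fintype ι] [DecidableEq ι] :
    List ι → (EuclideanSpace ℝ ι → ℝ) → (EuclideanSpace ℝ ι → ℝ)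
  | [], φ => φ
  | i :: l, φ => partialDeriv i (iterPartialDeriv l φ)

/-- `g` is the weak derivative of `f` of multi-index `l`. -/
def HasWeakDeriv {ι : Type*} [Fintype ι] [DecidableEq ι] (l : List ι)
    (f g : EuclideanSpace ℝ ι → ℝ) : Prop :=
  LocallyIntegrable f ∧ LocallyIntegrable g ∧
    ∀ φ : EuclideanSpace ℝ ι → ℝ, ContDiff ℝ ∞ φ → HasCompactSupport φ →
      ∫ x, f x * iterPartialDeriv l φ x = (-1) ^ l.length * ∫ x, g x * φ x

open Classical in
/-- A representative of the weak derivative of `f` (unique up to null sets); it is `0` by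
convention when `f` has no weak derivative of multi-index `l`. -/
noncomputable def weakDeriv {ι : Type*} [Fintype ι] [DecidableEq ι] (l : List ι)
    (f : EuclideanSpace ℝ ι → ℝ) : EuclideanSpace ℝ ι → ℝ :=
  if h : ∃ g, HasWeakDeriv l f g then h.choose else 0

/-- The Sobolev space `H^k(ℝⁿ)`: locally integrable functions whose weak derivatives of order at
most `k` exist and are square integrable. -/
def MemSobolev {ι : Type*} [Fintype ι] [DecidableEq ι] (k : ℕ)
    (f : EuclideanSpace ℝ ι → ℝ) : Prop :=
  LocallyIntegrable f ∧
    ∀ l : List ι, l.length ≤ k → ∃ g, HasWeakDeriv l f g ∧ MemLp g 2 volume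

/-- The inner product of `H²(ℝⁿ)`. -/
noncomputable def inner0 {ι : Type*} [Fintype ι] [DecidableEq ι]
    (f g : EuclideanSpace ℝ ι → ℝ) : ℝ :=
  (∫ x, f x * g x) + (∑ i, ∫ x, weakDeriv [i] f x * weakDeriv [i] g x)
    + ∑ i, ∑ j, ∫ x, weakDeriv [i, j] f x * weakDeriv [i, j] g x

/-- The norm of `H²(ℝⁿ)`. -/
noncomputable def norm0 {ι : Type*} [Fintype ι] [DecidableEq ι]
    (f : EuclideanSpace ℝ ι → ℝ) : ℝ :=
  √(inner0 f f)

/-- The space `C₀`: the closure of the smooth functions in the `H²`-norm. -/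
def C0 (ι : Type*) [Fintype ι] [DecidableEq ι] : Set (EuclideanSpace ℝ ι → ℝ) :=
  {f | MemSobolev 2 f ∧ ∀ ε : ℝ, 0 < ε →
    ∃ g : EuclideanSpace ℝ ι → ℝ, ContDiff ℝ ∞ g ∧ MemSobolev 2 g ∧ norm0 (f - g) < ε}

/-- The space of square integrable vector fields on `ℝⁿ`. -/
def TildeC1 (ι : Type*) [Fintype ι] : Set (EuclideanSpace ℝ ι → EuclideanSpace ℝ ι) :=
  {X | ∀ i, MemLp (fun x => X x i) 2 volume}

/-- The `L²` inner product of vector fields. -/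
noncomputable def innerTilde1 {ι : Type*} [Fintype ι]
    (X Y : EuclideanSpace ℝ ι → EuclideanSpace ℝ ι) : ℝ :=
  ∑ i, ∫ x, X x i * Y x i

/-- The operator sending `f` to its (weak) gradient field. -/
noncomputable def tildeD1 {ι : Type*} [Fintype ι] [DecidableEq ι]
    (f : EuclideanSpace ℝ ι → ℝ) : EuclideanSpace ℝ ι → EuclideanSpace ℝ ι :=
  fun x => WithLp.toLp 2 (fun i => weakDeriv [i] f x)

/-- The orthogonal complement, among square integrable fields, of the image of `C₀` under the
gradient operator. -/
def imTildeD1Perp (ι : Type*) [Fintype ι] [DecidableEq ι] :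
    Set (EuclideanSpace ℝ ι → EuclideanSpace ℝ ι) :=
  {X | X ∈ TildeC1 ι ∧ ∀ f ∈ C0 ι, innerTilde1 (tildeD1 f) X = 0}

/-- Joint strategies of `M` players, the strategy space of player `m` being `ℝ^(d m)`. The
coordinate `⟨m, j⟩` is the `j`-th coordinate of player `m`. -/
abbrev Strategy {M : ℕ} (d : Fin M → ℕ) : Type :=
  EuclideanSpace ℝ (Σ m : Fin M, Fin (d m))

/-- A game is given by the utility functions of its players. -/
abbrev Game {M : ℕ} (d : Fin M → ℕ) : Type :=
  Fin M → Strategy d → ℝ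

/-- The simultaneous gradient `Du = (∇_{ω₁} u₁, …, ∇_{ω_M} u_M)`, in the weak sense. -/
noncomputable def simGrad {M : ℕ} {d : Fin M → ℕ} (u : Game d) : Strategy d → Strategy d :=
  fun x => WithLp.toLp 2 (fun i => weakDeriv [i] (u i.1) x)

/-- Exact vector potential games: `Du ≠ 0` and `Du` is orthogonal to all gradient fields, together
with the zero game. -/
def TildeV {M : ℕ} (d : Fin M → ℕ) : Set (Game d) :=
  {u | (∀ m, u m ∈ C0 (Σ m : Fin M, Fin (d m))) ∧
    ((¬ simGrad u =ᵐ[volume] 0 ∧ simGrad u ∈ imTildeD1Perp (Σ m : Fin M, Fin (d m)))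
      ∨ ∀ m, u m =ᵐ[volume] 0)}

/-- Non-strategic games: smooth utilities in `C₀` with `Du = 0`. -/
def TildeN {M : ℕ} (d : Fin M → ℕ) : Set (Game d) :=
  {u | (∀ m, u m ∈ C0 (Σ m : Fin M, Fin (d m)) ∧ ContDiff ℝ ∞ (u m)) ∧
    simGrad u =ᵐ[volume] 0}

/-- Vector potential games: sums of an exact vector potential game and a non-strategic game. -/
def IsVectorPotentialGame {M : ℕ} {d : Fin M → ℕ} (u : Game d) : Prop :=
  ∃ v ∈ TildeV d, ∃ w ∈ TildeN d, u = v + w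

/-- `θ` is the forward flow of `X` on `Ω`: for every `x ∈ Ω` the curve `t ↦ θ t x`, `t ≥ 0`, solves
`ẋ = X(x)`, `x(0) = x`. -/
def IsForwardFlowOn {E : Type*} [NormedAddCommGroup E] [NormedSpace ℝ E]
    (X : E → E) (Ω : Set E) (θ : ℝ → E → E) : Prop :=
  ∀ x ∈ Ω, θ 0 x = x ∧
    ∀ t : ℝ, 0 ≤ t → HasDerivWithinAt (fun s => θ s x) (X (θ t x)) (Set.Ici 0) t

/-- Bounded orbits: `Ω` is compact and no trajectory starting in `Ω` leaves it. -/
def BoundedOrbits {E : Type*} [TopologicalSpace E] (Ω : Set E) (θ : ℝ → E → E) : Prop :=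
  IsCompact Ω ∧ ∀ x ∈ Ω, ∀ t : ℝ, 0 ≤ t → θ t x ∈ Ω

/-- Poincaré recurrence on `Ω`: for almost every `x ∈ Ω` there are times `s k → ∞` at which the
trajectory of `x` comes back to `x` in the limit. -/
def IsPoincareRecurrentOn {E : Type*} [TopologicalSpace E] [MeasureSpace E]
    (Ω : Set E) (θ : ℝ → E → E) : Prop :=
  ∀ᵐ x ∂(volume.restrict Ω), ∃ s : ℕ → ℝ,
    Tendsto s atTop atTop ∧ Tendsto (fun k => θ (s k) x) atTop (𝓝 x)

end DiffGame

/-! Test functions lie in `C0`, so orthogonality of `Du` to gradients makes it weakly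
divergence-free; the non-strategic summand does not change `Du` almost everywhere. Since the
representative `X` is smooth, its divergence vanishes at every point
(`trace_fderiv_eq_zero_of_integral_eq_zero`). What remains is Liouville's theorem followed by
Poincaré recurrence for the time-one map on the finite-measure set `Ω`.

The map `θ 1` is controlled only on `Ω`, so Liouville is proved without differentiating it. Run the
Euler scheme with step `1/n`: each step is injective with Jacobian at least `1 - ε/n`, so `n` steps
shrink volume by a factor no worse than `1 - ε`, while the Euler image of a compact `C` lies within
`O(1/n)` of `θ 1 '' C`. Letting `n → ∞` and then `ε → 0` gives `μ C ≤ μ (θ 1 '' C)`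
(`measure_le_measure_image_flow`). As `θ 1` maps `Ω` to itself, this one-sided bound already forces
measure preservation (`measurePreserving_of_measure_le_image`). -/

namespace DiffGame

/-! ### Determinants near the identity -/

section Determinant

variable {E : Type*} [NormedAddCommGroup E] [NormedSpace ℝ E] [FiniteDimensional ℝ E]

theorem differentiable_det : Differentiable ℝ (fun A : E →L[ℝ] E => A.det) := by
  let b := Module.finBasis ℝ E
  have h : (fun A : E →L[ℝ] E => A.det) =
      fun A : E →L[ℝ] E => ∑ σ : Equiv.Perm (Fin (Module.finrank ℝ E)),
        (Equiv.Perm.sign σ : ℤ) • ∏ i, LinearMap.toMatrix b b (A : E →ₗ[ℝ] E) (σ i) i := by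
    funext A
    rw [ContinuousLinearMap.det, ← LinearMap.det_toMatrix b, Matrix.det_apply]
    rfl
  rw [h]
  have hent : ∀ i j, Differentiable ℝ
      (fun A : E →L[ℝ] E => LinearMap.toMatrix b b (A : E →ₗ[ℝ] E) i j) := by
    intro i j
    let φ : (E →L[ℝ] E) →ₗ[ℝ] ℝ :=
      { toFun := fun A => LinearMap.toMatrix b b (A : E →ₗ[ℝ] E) i j
        map_add' := fun A B => by simp [LinearMap.toMatrix_apply]
        map_smul' := fun c A => by simp [LinearMap.toMatrix_apply] }
    exact (LinearMap.toContinuousLinearMap φ).differentiable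
  fun_prop

theorem hasDerivAt_det_one_add_smul (A : E →L[ℝ] E) :
    HasDerivAt (fun r : ℝ => (1 + r • A).det) (LinearMap.trace ℝ E (A : E →ₗ[ℝ] E)) 0 := by
  let b := Module.finBasis ℝ E
  let N := LinearMap.toMatrix b b (A : E →ₗ[ℝ] E)
  -- The quotient left after removing the constant and linear terms of `det (1 + X N)`, so the
  -- remainder is `p(r) r²`.
  let p : Polynomial ℝ :=
    (Matrix.det (1 + (Polynomial.X : Polynomial ℝ) • N.map Polynomial.C)).divX.divX
  have h : (fun r : ℝ => (1 + r • A).det) = fun r => 1 + N.trace * r + p.eval r * r ^ 2 := by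
    funext r
    rw [← Matrix.det_one_add_smul, ContinuousLinearMap.det, ← LinearMap.det_toMatrix b]
    congr 1
    simp [N, LinearMap.toMatrix_one]
  rw [h, LinearMap.trace_eq_matrix_trace ℝ b]
  have h1 : HasDerivAt (fun r : ℝ => 1 + N.trace * r + p.eval r * r ^ 2)
      (N.trace * 1 + (p.derivative.eval 0 * (0 : ℝ) ^ 2 + p.eval 0 * 0)) 0 := by
    refine ((((hasDerivAt_id (0 : ℝ)).const_mul N.trace).const_add 1).add
      ((p.hasDerivAt 0).mul ?_))
    simpa using hasDerivAt_pow 2 (0 : ℝ)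
  simpa using h1

/-- First order expansion of the determinant at the identity, uniform over bounded sets of
trace-free operators. -/
theorem exists_le_det_one_add_smul (K : ℝ) {ε : ℝ} (hε : 0 < ε) :
    ∃ δ > 0, ∀ A : E →L[ℝ] E, ‖A‖ ≤ K → LinearMap.trace ℝ E (A : E →ₗ[ℝ] E) = 0 →
      ∀ h : ℝ, 0 ≤ h → h ≤ δ → 1 - ε * h ≤ (1 + h • A).det := by
  obtain ⟨K', hK', hKK'⟩ : ∃ K' > 0, K ≤ K' := ⟨max K 1, by positivity, le_max_left _ _⟩
  set L := fderiv ℝ (fun A : E →L[ℝ] E => A.det) 1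
  have hL : HasFDerivAt (fun A : E →L[ℝ] E => A.det) L 1 := (differentiable_det 1).hasFDerivAt
  have htr : ∀ A : E →L[ℝ] E, L A = LinearMap.trace ℝ E (A : E →ₗ[ℝ] E) := by
    intro A
    have h1 : HasDerivAt (fun r : ℝ => (1 : E →L[ℝ] E) + r • A) A 0 := by
      simpa using ((hasDerivAt_id (0 : ℝ)).smul_const A).const_add (1 : E →L[ℝ] E)
    have h2 : HasFDerivAt (fun A : E →L[ℝ] E => A.det) L ((1 : E →L[ℝ] E) + (0 : ℝ) • A) := by
      simpa using hL
    have h3 : HasDerivAt (fun r : ℝ => (1 + r • A).det) (L A) 0 :=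
      HasFDerivAt.comp_hasDerivAt (l := fun A : E →L[ℝ] E => A.det) (0 : ℝ) h2 h1
    exact h3.unique (hasDerivAt_det_one_add_smul A)
  -- The little-o constant `ε / K'` turns into the error `ε * h`, because `‖h • A‖ ≤ h * K'`.
  have ho := (hasFDerivAt_iff_isLittleO_nhds_zero.1 hL).def (div_pos hε hK')
  obtain ⟨η, hη, hball⟩ := Metric.eventually_nhds_iff.1 ho
  refine ⟨η / (2 * K'), by positivity, fun A hA hA0 h h0 hh => ?_⟩
  have hn : ‖h • A‖ ≤ h * K' := by
    rw [norm_smul, Real.norm_of_nonneg h0]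
    gcongr
    exact hA.trans hKK'
  have hlt : h * K' < η := by
    have : h * (2 * K') ≤ η := (le_div_iff₀ (by positivity)).1 hh
    nlinarith
  have := hball (y := h • A) (by simpa using hn.trans_lt hlt)
  rw [htr] at this
  have htr0 : LinearMap.trace ℝ E ((h • A : E →L[ℝ] E) : E →ₗ[ℝ] E) = 0 := by simp [hA0]
  rw [htr0] at this
  have hdet1 : (1 : E →L[ℝ] E).det = 1 := by simp [ContinuousLinearMap.det]
  rw [hdet1, sub_zero, Real.norm_eq_abs] at this
  have h3 : ε / K' * ‖h • A‖ ≤ ε * h := by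
    calc ε / K' * ‖h • A‖ ≤ ε / K' * (h * K') := by gcongr
      _ = ε * h := by field_simp
  have := (abs_le.1 this).1
  linarith

end Determinant

/-! ### Euler scheme and Liouville's theorem -/

section Euler

variable {E : Type*} [NormedAddCommGroup E] [NormedSpace ℝ E]

/-- One step of the explicit Euler scheme. -/
def eulerStep (Y : E → E) (h : ℝ) (x : E) : E := x + h • Y x

/-- Local error: during one step the trajectory moves by at most `B h`, so the field along it varies
by at most `K B h`; integrate over length `h`. -/
theorem norm_sub_eulerStep_le {Y : E → E} {K : NNReal} {B : ℝ} (hY : LipschitzWith K Y)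
    (hB : ∀ x, ‖Y x‖ ≤ B) {γ : ℝ → E}
    (hγ : ∀ t, 0 ≤ t → HasDerivWithinAt γ (Y (γ t)) (Set.Ici 0) t) {s h : ℝ}
    (hs : 0 ≤ s) (hh : 0 ≤ h) :
    ‖γ (s + h) - eulerStep Y h (γ s)‖ ≤ K * B * h * h := by
  have hB0 : 0 ≤ B := (norm_nonneg _).trans (hB 0)
  have hd : ∀ r ∈ Set.Icc s (s + h), HasDerivWithinAt γ (Y (γ r)) (Set.Icc s (s + h)) r :=
    fun r hr => (hγ r (hs.trans hr.1)).mono fun q hq => hs.trans hq.1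
  have h1 : ∀ r ∈ Set.Icc s (s + h), ‖γ r - γ s‖ ≤ B * (r - s) :=
    norm_image_sub_le_of_norm_deriv_le_segment' hd fun r _ => hB _
  have hd2 : ∀ r ∈ Set.Icc s (s + h), HasDerivWithinAt (fun r => γ r - (r - s) • Y (γ s))
      (Y (γ r) - Y (γ s)) (Set.Icc s (s + h)) r := by
    intro r hr
    have : HasDerivWithinAt (fun r : ℝ => (r - s) • Y (γ s)) ((1 : ℝ) • Y (γ s))
        (Set.Icc s (s + h)) r :=
      ((hasDerivWithinAt_id r _).sub_const s).smul_const _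
    simpa using (hd r hr).fun_sub this
  have h2 := norm_image_sub_le_of_norm_deriv_le_segment' hd2 (C := K * B * h) (fun r hr => by
    have h3 : ‖Y (γ r) - Y (γ s)‖ ≤ K * ‖γ r - γ s‖ := hY.norm_sub_le _ _
    have h4 := h1 r ⟨hr.1, hr.2.le⟩
    have h5 : B * (r - s) ≤ B * h := mul_le_mul_of_nonneg_left (by linarith [hr.2]) hB0
    calc _ ≤ K * ‖γ r - γ s‖ := h3
      _ ≤ K * (B * h) := by gcongr; exact h4.trans h5
      _ = K * B * h := by ring) (s + h) ⟨by linarith, le_rfl⟩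
  have e : γ (s + h) - eulerStep Y h (γ s)
      = γ (s + h) - (s + h - s) • Y (γ s) - (γ s - (s - s) • Y (γ s)) := by
    simp only [eulerStep, add_sub_cancel_left, sub_self, zero_smul, sub_zero]
    abel
  rw [e]
  simpa using h2

/-- Discrete Grönwall: the errors satisfy `e (k+1) ≤ (1 + K h) e k + K B h²`, and the bound solves
this recursion with equality. -/
theorem norm_iterate_eulerStep_sub_le {Y : E → E} {K : NNReal} {B : ℝ} (hY : LipschitzWith K Y)
    (hB : ∀ x, ‖Y x‖ ≤ B) {γ : ℝ → E}
    (hγ : ∀ t, 0 ≤ t → HasDerivWithinAt γ (Y (γ t)) (Set.Ici 0) t) {h : ℝ} (hh : 0 ≤ h) (k : ℕ) :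
    ‖(eulerStep Y h)^[k] (γ 0) - γ (k * h)‖ ≤ B * h * ((1 + K * h) ^ k - 1) := by
  induction k with
  | zero => simp
  | succ k ih =>
    rw [Function.iterate_succ_apply']
    set e := (eulerStep Y h)^[k] (γ 0)
    have h1 := norm_sub_eulerStep_le hY hB hγ (s := k * h) (by positivity) hh
    have h2 : ‖eulerStep Y h e - eulerStep Y h (γ (k * h))‖
        ≤ (1 + K * h) * ‖e - γ (k * h)‖ := by
      have : eulerStep Y h e - eulerStep Y h (γ (k * h))
          = (e - γ (k * h)) + h • (Y e - Y (γ (k * h))) := by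
        simp only [eulerStep, smul_sub]; abel
      rw [this]
      refine (norm_add_le _ _).trans ?_
      rw [norm_smul, Real.norm_of_nonneg hh]
      have := mul_le_mul_of_nonneg_left (hY.norm_sub_le e (γ (k * h))) hh
      linarith
    have h3 : ((k + 1 : ℕ) : ℝ) * h = k * h + h := by push_cast; ring
    rw [h3]
    have h4 : ‖eulerStep Y h e - γ (k * h + h)‖
        ≤ ‖eulerStep Y h e - eulerStep Y h (γ (k * h))‖
          + ‖γ (k * h + h) - eulerStep Y h (γ (k * h))‖ := by
      rw [norm_sub_rev (γ (k * h + h))]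
      exact norm_sub_le_norm_sub_add_norm_sub _ _ _
    have h5 : (1 + K * h) * ‖e - γ (k * h)‖
        ≤ (1 + K * h) * (B * h * ((1 + K * h) ^ k - 1)) := by gcongr
    calc _ ≤ (1 + K * h) * (B * h * ((1 + K * h) ^ k - 1)) + K * B * h * h := by linarith
      _ = _ := by ring

/-- The step is the identity plus a strict contraction. -/
theorem injective_eulerStep {Y : E → E} {K : NNReal} (hY : LipschitzWith K Y) {h : ℝ}
    (hh : 0 ≤ h) (hK : K * h < 1) : Function.Injective (eulerStep Y h) := by
  intro x y hxy
  have h1 : x - y = h • (Y y - Y x) := by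
    simp only [eulerStep] at hxy
    rw [smul_sub, sub_eq_sub_iff_add_eq_add, hxy, add_comm]
  have h2 : ‖x - y‖ ≤ K * h * ‖x - y‖ := by
    have := mul_le_mul_of_nonneg_left (hY.norm_sub_le y x) hh
    rw [norm_sub_rev y x] at this
    calc ‖x - y‖ = h * ‖Y y - Y x‖ := by rw [h1, norm_smul, Real.norm_of_nonneg hh]
      _ ≤ _ := by linarith
  have h3 : ‖x - y‖ = 0 := by nlinarith [norm_nonneg (x - y)]
  exact sub_eq_zero.1 (norm_eq_zero.1 h3)

variable [FiniteDimensional ℝ E] [MeasurableSpace E] [BorelSpace E]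

theorem le_measure_image_eulerStep (μ : Measure E) [μ.IsAddHaarMeasure] {Y : E → E} {K : NNReal}
    (hY : LipschitzWith K Y) (hYd : Differentiable ℝ Y) {h c : ℝ} (hh : 0 ≤ h) (hK : K * h < 1)
    {S : Set E} (hS : MeasurableSet S) (hdet : ∀ x ∈ S, c ≤ (1 + h • fderiv ℝ Y x).det) :
    ENNReal.ofReal c * μ S ≤ μ (eulerStep Y h '' S) := by
  have hd : ∀ x ∈ S, HasFDerivWithinAt (eulerStep Y h) (1 + h • fderiv ℝ Y x) S x := fun x _ =>
    ((hasFDerivAt_id x).add ((hYd x).hasFDerivAt.const_smul h)).hasFDerivWithinAt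
  rw [← lintegral_abs_det_fderiv_eq_addHaar_image μ hS hd
    (injective_eulerStep hY hh hK).injOn, ← setLIntegral_const]
  exact setLIntegral_mono' hS fun x hx =>
    ENNReal.ofReal_le_ofReal ((hdet x hx).trans (le_abs_self _))

/-- The flow of a field which is divergence-free near an invariant set `Ω` does not decrease the
measure of compact subsets of `Ω`. -/
theorem measure_le_measure_image_flow (μ : Measure E) [μ.IsAddHaarMeasure] {Y : E → E} {K : NNReal}
    {B r : ℝ} (hY : LipschitzWith K Y) (hB : ∀ x, ‖Y x‖ ≤ B) (hYd : Differentiable ℝ Y)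
    {Ω : Set E} (hr : 0 < r)
    (hdiv : ∀ x ∈ Metric.thickening r Ω, LinearMap.trace ℝ E (fderiv ℝ Y x : E →ₗ[ℝ] E) = 0)
    {θ : ℝ → E → E} (hθ : IsForwardFlowOn Y Ω θ) (hΩ : ∀ x ∈ Ω, ∀ t : ℝ, 0 ≤ t → θ t x ∈ Ω)
    (hcont : ContinuousOn (θ 1) Ω) {C : Set E} (hC : IsCompact C) (hCΩ : C ⊆ Ω) :
    μ C ≤ μ (θ 1 '' C) := by
  have hB0 : 0 ≤ B := (norm_nonneg _).trans (hB 0)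
  have hinv : Tendsto (fun n : ℕ => ((n : ℝ))⁻¹) atTop (𝓝 0) := tendsto_inv_atTop_nhds_zero_nat
  -- From `(1 + K/n)^k ≤ exp K`, uniformly in `k ≤ n`.
  set D : ℝ := B * Real.exp K
  have herr : Tendsto (fun n : ℕ => D * (n : ℝ)⁻¹) atTop (𝓝 0) := by
    simpa using hinv.const_mul D
  have hclose : ∀ n : ℕ, 0 < n → ∀ k ≤ n, ∀ x ∈ Ω,
      dist ((eulerStep Y (n : ℝ)⁻¹)^[k] x) (θ (k * (n : ℝ)⁻¹) x) ≤ D * (n : ℝ)⁻¹ := by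
    intro n hn k hk x hx
    have h1 := norm_iterate_eulerStep_sub_le hY hB (γ := fun s => θ s x) (hθ x hx).2
      (h := (n : ℝ)⁻¹) (by positivity) k
    simp only [(hθ x hx).1] at h1
    rw [dist_eq_norm]
    refine h1.trans ?_
    have hn0 : (0 : ℝ) < n := by exact_mod_cast hn
    have h2 : (1 + K * (n : ℝ)⁻¹) ^ k ≤ Real.exp K := by
      calc (1 + K * (n : ℝ)⁻¹) ^ k ≤ (1 + K * (n : ℝ)⁻¹) ^ n :=
            pow_le_pow_right₀ (by simp; positivity) hk
        _ ≤ Real.exp (K * (n : ℝ)⁻¹) ^ n := by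
            gcongr
            rw [add_comm]
            exact Real.add_one_le_exp _
        _ = Real.exp K := by rw [← Real.exp_nat_mul]; congr 1; field_simp
    calc _ = B * ((1 + K * (n : ℝ)⁻¹) ^ k - 1) * (n : ℝ)⁻¹ := by ring
      _ ≤ D * (n : ℝ)⁻¹ := by
        gcongr
        exact mul_le_mul_of_nonneg_left (by linarith) hB0
  have himage : IsCompact (θ 1 '' C) := hC.image_of_continuousOn (hcont.mono hCΩ)
  have hEcont : ∀ h, Continuous (eulerStep Y h) := fun h =>
    continuous_id.add (hY.continuous.const_smul h)
  have key : ∀ ε : ℝ, 0 < ε → ε < 1 → ENNReal.ofReal (1 - ε) * μ C ≤ μ (θ 1 '' C) := by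
    intro ε hε hε1
    obtain ⟨δ, hδ, hdet⟩ := exists_le_det_one_add_smul (E := E) (K : ℝ) hε
    have hKt : Tendsto (fun n : ℕ => (K : ℝ) * (n : ℝ)⁻¹) atTop (𝓝 0) := by
      simpa using hinv.const_mul (K : ℝ)
    refine ge_of_tendsto ((tendsto_measure_cthickening_of_isCompact himage).comp herr) ?_
    -- With `h = 1/n`: `h ≤ δ` gives the determinant bound, `K h < 1` injectivity, and `D h < r`
    -- keeps the Euler iterates where the divergence vanishes.
    filter_upwards [eventually_gt_atTop 0, hinv.eventually (eventually_le_nhds hδ),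
      hKt.eventually (eventually_lt_nhds one_pos), herr.eventually (eventually_lt_nhds hr)]
      with n hn hnδ hnK hnr
    set h : ℝ := (n : ℝ)⁻¹
    have hn0 : (0 : ℝ) < n := by exact_mod_cast hn
    have hh : 0 ≤ h := by positivity
    have hh1 : h ≤ 1 := inv_le_one_of_one_le₀ (by exact_mod_cast hn)
    have hfac : 0 ≤ 1 - ε * h := by nlinarith
    have hiter : ∀ k ≤ n, ENNReal.ofReal ((1 - ε * h) ^ k) * μ C
        ≤ μ ((eulerStep Y h)^[k] '' C) := by
      intro k
      induction k with
      | zero => simp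
      | succ k ih =>
        intro hk
        have hS : IsCompact ((eulerStep Y h)^[k] '' C) := hC.image ((hEcont h).iterate k)
        have hstep := le_measure_image_eulerStep μ hY hYd (h := h) (c := 1 - ε * h) hh hnK
          hS.measurableSet (by
            rintro _ ⟨x, hx, rfl⟩
            -- Euler iterates may leave `Ω`, but they shadow the true orbit, which does not.
            refine hdet _ (norm_fderiv_le_of_lipschitz ℝ hY) (hdiv _ ?_) h hh hnδ
            exact Metric.mem_thickening_iff.2 ⟨θ (k * h) x, hΩ x (hCΩ hx) _ (by positivity),
              (hclose n hn k (by omega) x (hCΩ hx)).trans_lt hnr⟩)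
        rw [Function.iterate_succ', Set.image_comp, pow_succ', ENNReal.ofReal_mul hfac, mul_assoc]
        exact (mul_le_mul_right (ih (by omega)) _).trans hstep
    have hbern : 1 - ε ≤ (1 - ε * h) ^ n := by
      have := one_add_mul_le_pow (a := -(ε * h)) (by nlinarith) n
      have e : (n : ℝ) * (ε * h) = ε := by simp only [h]; field_simp
      rw [← sub_eq_add_neg] at this
      linarith
    calc ENNReal.ofReal (1 - ε) * μ C ≤ ENNReal.ofReal ((1 - ε * h) ^ n) * μ C := by
          gcongr
      _ ≤ μ ((eulerStep Y h)^[n] '' C) := hiter n le_rfl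
      _ ≤ μ (Metric.cthickening (D * h) (θ 1 '' C)) := by
          refine measure_mono ?_
          rintro _ ⟨x, hx, rfl⟩
          refine Metric.mem_cthickening_of_dist_le _ (θ 1 x) _ _ ⟨x, hx, rfl⟩ ?_
          have := hclose n hn n le_rfl x (hCΩ hx)
          rwa [mul_inv_cancel₀ hn0.ne'] at this
  -- Take `ε = 1/(n+2)`; the shift by 2 keeps `ε < 1` even at `n = 0`.
  have hlim : Tendsto (fun n : ℕ => ENNReal.ofReal (1 - ((n : ℝ) + 2)⁻¹) * μ C) atTop
      (𝓝 (ENNReal.ofReal 1 * μ C)) := by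
    refine ENNReal.Tendsto.mul_const (ENNReal.tendsto_ofReal ?_) (Or.inl (by simp))
    have : Tendsto (fun n : ℕ => ((n : ℝ) + 2)⁻¹) atTop (𝓝 0) :=
      tendsto_inv_atTop_zero.comp
        (tendsto_atTop_add_const_right _ _ tendsto_natCast_atTop_atTop)
    simpa using this.const_sub 1
  rw [ENNReal.ofReal_one, one_mul] at hlim
  refine le_of_tendsto hlim (Eventually.of_forall fun n => key _ (by positivity) ?_)
  exact inv_lt_one_of_one_lt₀ (by linarith [(Nat.cast_nonneg n : (0 : ℝ) ≤ n)])

end Euler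


/-! ### Flow properties, measure preservation and recurrence -/

section Recurrence

variable {E : Type*} [NormedAddCommGroup E] [NormedSpace ℝ E]

theorem IsForwardFlowOn.continuousOn_trajectory {Y : E → E} {Ω : Set E} {θ : ℝ → E → E}
    (hθ : IsForwardFlowOn Y Ω θ) {x : E} (hx : x ∈ Ω) :
    ContinuousOn (fun s => θ s x) (Set.Ici 0) :=
  fun t ht => ((hθ x hx).2 t ht).continuousWithinAt

theorem IsForwardFlowOn.hasDerivWithinAt_Ici {Y : E → E} {Ω : Set E} {θ : ℝ → E → E}
    (hθ : IsForwardFlowOn Y Ω θ) {x : E} (hx : x ∈ Ω) {t : ℝ} (ht : 0 ≤ t) :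
    HasDerivWithinAt (fun s => θ s x) (Y (θ t x)) (Set.Ici t) t :=
  ((hθ x hx).2 t ht).mono (Set.Ici_subset_Ici.2 ht)

/-- Grönwall's inequality for two trajectories. -/
theorem IsForwardFlowOn.lipschitzOnWith {Y : E → E} {K : NNReal} (hY : LipschitzWith K Y)
    {Ω : Set E} {θ : ℝ → E → E} (hθ : IsForwardFlowOn Y Ω θ) {t : ℝ} (ht : 0 ≤ t) :
    LipschitzOnWith (Real.exp (K * t)).toNNReal (θ t) Ω := by
  refine LipschitzOnWith.of_dist_le_mul fun x hx y hy => ?_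
  have h := dist_le_of_trajectories_ODE (v := fun _ => Y) (a := 0) (b := t)
    (δ := dist x y) (fun _ => hY)
    ((hθ.continuousOn_trajectory hx).mono Set.Icc_subset_Ici_self)
    (fun s hs => hθ.hasDerivWithinAt_Ici hx hs.1)
    ((hθ.continuousOn_trajectory hy).mono Set.Icc_subset_Ici_self)
    (fun s hs => hθ.hasDerivWithinAt_Ici hy hs.1)
    (by rw [(hθ x hx).1, (hθ y hy).1]) t ⟨ht, le_rfl⟩
  rw [Real.coe_toNNReal _ (Real.exp_pos _).le, mul_comm]
  simpa using h

/-- The semigroup law of a forward flow on an invariant set. -/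
theorem IsForwardFlowOn.flow_add {Y : E → E} {K : NNReal} (hY : LipschitzWith K Y)
    {Ω : Set E} {θ : ℝ → E → E} (hθ : IsForwardFlowOn Y Ω θ)
    (hΩ : ∀ x ∈ Ω, ∀ t : ℝ, 0 ≤ t → θ t x ∈ Ω) {x : E} (hx : x ∈ Ω) {s t : ℝ}
    (hs : 0 ≤ s) (ht : 0 ≤ t) : θ s (θ t x) = θ (s + t) x := by
  have hy := hΩ x hx t ht
  have hshift : ∀ q : ℝ, 0 ≤ q →
      HasDerivWithinAt (fun q => θ (q + t) x) (Y (θ (q + t) x)) (Set.Ici 0) q := by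
    intro q hq
    have h1 : HasDerivWithinAt (fun q : ℝ => q + t) 1 (Set.Ici 0) q :=
      (hasDerivWithinAt_id q _).add_const t
    have h2 := ((hθ x hx).2 (q + t) (by linarith)).scomp q h1
      (fun p (hp : 0 ≤ p) => (by simp only [Set.mem_Ici]; linarith))
    simpa [Function.comp_def] using h2
  exact ODE_solution_unique (v := fun _ => Y) (a := 0) (b := s)
    (f := fun q => θ q (θ t x)) (g := fun q => θ (q + t) x) (fun _ => hY)
    ((hθ.continuousOn_trajectory hy).mono Set.Icc_subset_Ici_self)
    (fun q hq => hθ.hasDerivWithinAt_Ici hy hq.1)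
    (fun q hq => (hshift q hq.1).continuousWithinAt.mono Set.Icc_subset_Ici_self)
    (fun q hq => (hshift q hq.1).mono (Set.Ici_subset_Ici.2 hq.1))
    (by simp [(hθ _ hy).1]) ⟨hs, le_rfl⟩

/-- A smooth field agrees near a compact set with a compactly supported
smooth field. -/
theorem exists_compactlySupported_eqOn_thickening [FiniteDimensional ℝ E]
    {X : E → E} (hX : ContDiff ℝ ∞ X) {Ω : Set E}
    (hΩ : IsCompact Ω) : ∃ Y : E → E, ContDiff ℝ ∞ Y ∧ HasCompactSupport Y ∧
      Set.EqOn Y X (Metric.thickening 1 Ω) := by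
  obtain ⟨R, hR0, hR⟩ : ∃ R : ℝ, 0 < R ∧ Ω ⊆ Metric.closedBall 0 R := by
    obtain ⟨R, hR⟩ := hΩ.isBounded.subset_closedBall (0 : E)
    exact ⟨max R 1, by positivity, hR.trans (Metric.closedBall_subset_closedBall (le_max_left _ _))⟩
  -- Inner radius `R + 1`, so that the bump equals 1 on the whole 1-thickening of `Ω`.
  let χ : ContDiffBump (0 : E) := ⟨R + 1, R + 2, by linarith, by linarith⟩
  refine ⟨fun x => χ x • X x, χ.contDiff.smul hX, χ.hasCompactSupport.smul_right, fun x hx => ?_⟩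
  obtain ⟨y, hy, hxy⟩ := Metric.mem_thickening_iff.1 hx
  have : χ x = 1 := χ.one_of_mem_closedBall (by
    have h1 := Metric.mem_closedBall.1 (hR hy)
    have h2 := dist_triangle x y 0
    exact Metric.mem_closedBall.2 (by change dist x 0 ≤ R + 1; linarith))
  simp [this]

variable [FiniteDimensional ℝ E] [MeasurableSpace E] [BorelSpace E]

/-- A self-map of a compact set which does not decrease the measure of compact subsets preserves
the measure. -/
theorem measurePreserving_of_measure_le_image {μ : Measure E} [IsFiniteMeasureOnCompacts μ]
    {Ω : Set E} (hΩ : IsCompact Ω) {T : E → E} (hT : Measurable T) (hmap : Set.MapsTo T Ω Ω)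
    (hle : ∀ C, IsCompact C → C ⊆ Ω → μ C ≤ μ (T '' C)) :
    MeasurePreserving T (μ.restrict Ω) (μ.restrict Ω) := by
  have : IsFiniteMeasure (μ.restrict Ω) := ⟨by simpa using hΩ.measure_lt_top⟩
  refine ⟨hT, ?_⟩
  have : IsFiniteMeasure ((μ.restrict Ω).map T) := inferInstance
  -- Both measures have the same finite total mass, so one inequality between them suffices; it is
  -- tested on compact subsets of the preimage.
  refine Measure.eq_of_le_of_measure_univ_eq ?_ (by
    rw [Measure.map_apply hT .univ, Set.preimage_univ])
  refine Measure.le_iff.2 fun s hs => ?_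
  rw [Measure.map_apply hT hs]
  have hpre : MeasurableSet (T ⁻¹' s) := hT hs
  rw [hpre.measure_eq_iSup_isCompact_of_ne_top (measure_ne_top _ _)]
  refine iSup₂_le fun C hC => iSup_le fun hCc => ?_
  have hCΩ : IsCompact (C ∩ Ω) := hCc.inter hΩ
  calc μ.restrict Ω C = μ (C ∩ Ω) := Measure.restrict_apply hCc.measurableSet
    _ ≤ μ (T '' (C ∩ Ω)) := hle _ hCΩ Set.inter_subset_right
    _ ≤ μ (s ∩ Ω) := measure_mono (by
        rintro _ ⟨x, ⟨hxC, hxΩ⟩, rfl⟩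
        exact ⟨hC hxC, hmap hxΩ⟩)
    _ = μ.restrict Ω s := (Measure.restrict_apply hs).symm

/-- Poincaré recurrence for a smooth divergence-free field with bounded orbits. -/
theorem exists_tendsto_flow_of_divergence_eq_zero (μ : Measure E) [μ.IsAddHaarMeasure]
    {X : E → E} (hX : ContDiff ℝ ∞ X)
    (hdiv : ∀ x, LinearMap.trace ℝ E (fderiv ℝ X x : E →ₗ[ℝ] E) = 0) {Ω : Set E} {θ : ℝ → E → E}
    (hθ : IsForwardFlowOn X Ω θ) (hΩ : BoundedOrbits Ω θ) :
    ∀ᵐ x ∂(μ.restrict Ω), ∃ s : ℕ → ℝ,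
      Tendsto s atTop atTop ∧ Tendsto (fun k => θ (s k) x) atTop (𝓝 x) := by
  classical
  obtain ⟨hcomp, hinv⟩ := hΩ
  obtain ⟨Y, hYs, hYc, hYX⟩ := exists_compactlySupported_eqOn_thickening hX hcomp
  have hsub : Ω ⊆ Metric.thickening 1 Ω := Metric.self_subset_thickening one_pos Ω
  have hθY : IsForwardFlowOn Y Ω θ := fun x hx => ⟨(hθ x hx).1, fun t ht => by
    rw [hYX (hsub (hinv x hx t ht))]
    exact (hθ x hx).2 t ht⟩
  obtain ⟨K, hK⟩ := hYs.lipschitzWith_of_hasCompactSupport hYc (by simp)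
  obtain ⟨B, hB⟩ := hYc.exists_bound_of_continuous hYs.continuous
  have hdivY : ∀ x ∈ Metric.thickening 1 Ω,
      LinearMap.trace ℝ E (fderiv ℝ Y x : E →ₗ[ℝ] E) = 0 := fun x hx => by
    rw [(hYX.eventuallyEq_of_mem (Metric.isOpen_thickening.mem_nhds hx)).fderiv_eq, hdiv]
  have hcont : ContinuousOn (θ 1) Ω := (hθY.lipschitzOnWith hK zero_le_one).continuousOn
  -- Extending by the identity off `Ω` makes the time-one map globally measurable.
  set T : E → E := Ω.piecewise (θ 1) id
  have hT : Measurable T :=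
    hcont.measurable_piecewise continuous_id.continuousOn hcomp.measurableSet
  have hTΩ : Set.EqOn T (θ 1) Ω := Set.piecewise_eqOn _ _ _
  have hmap : Set.MapsTo T Ω Ω := fun x hx => by
    rw [hTΩ hx]; exact hinv x hx 1 zero_le_one
  have hpres : MeasurePreserving T (μ.restrict Ω) (μ.restrict Ω) :=
    measurePreserving_of_measure_le_image hcomp hT hmap fun C hC hCΩ => by
      rw [(hTΩ.mono hCΩ).image_eq]
      exact measure_le_measure_image_flow μ hK hB (hYs.differentiable (by simp)) one_pos hdivY
        hθY hinv hcont hC hCΩ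
  have hiter : ∀ n : ℕ, ∀ x ∈ Ω, T^[n] x = θ n x := by
    intro n
    induction n with
    | zero => intro x hx; simp [(hθ x hx).1]
    | succ n ih =>
      intro x hx
      rw [Function.iterate_succ_apply', ih x hx, hTΩ (hinv x hx n n.cast_nonneg),
        hθY.flow_add hK hinv hx zero_le_one n.cast_nonneg, Nat.cast_succ, add_comm]
  have : IsFiniteMeasure (μ.restrict Ω) := ⟨by simpa using hcomp.measure_lt_top⟩
  filter_upwards [hpres.conservative.ae_frequently_mem_of_mem_nhds,
    ae_restrict_mem hcomp.measurableSet] with x hfreq hx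
  -- Returning infinitely often to every neighbourhood means clustering at `x`; first countability
  -- then yields integer return times.
  have hcl : MapClusterPt x atTop (fun n : ℕ => T^[n] x) :=
    mapClusterPt_iff_frequently.2 hfreq
  obtain ⟨ψ, hψ, hlim⟩ := hcl.tendsto_subseq
  refine ⟨fun k => (ψ k : ℝ), tendsto_natCast_atTop_atTop.comp hψ.tendsto_atTop, ?_⟩
  simpa [Function.comp_def, hiter _ x hx] using hlim

end Recurrence


/-! ### Weak derivatives and divergence -/

section Weak

theorem integrable_mul_of_contDiff
    {ι : Type*} [Fintype ι] {f φ : EuclideanSpace ℝ ι → ℝ} (hf : LocallyIntegrable f) (hφ : ContDiff ℝ ∞ φ)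
    (hφc : HasCompactSupport φ) : Integrable (fun x => f x * φ x) := by
  simpa [mul_comm] using hf.integrable_smul_left_of_hasCompactSupport hφ.continuous hφc

variable {ι : Type*} [Fintype ι] [DecidableEq ι]

theorem contDiff_partialDeriv {φ : EuclideanSpace ℝ ι → ℝ} (hφ : ContDiff ℝ ∞ φ) (i : ι) :
    ContDiff ℝ ∞ (partialDeriv i φ) :=
  (hφ.fderiv_right (m := ∞) (by simp)).clm_apply contDiff_const

theorem hasCompactSupport_partialDeriv {φ : EuclideanSpace ℝ ι → ℝ} (hφ : HasCompactSupport φ)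
    (i : ι) : HasCompactSupport (partialDeriv i φ) :=
  hφ.fderiv_apply ℝ _

theorem contDiff_iterPartialDeriv {φ : EuclideanSpace ℝ ι → ℝ} (hφ : ContDiff ℝ ∞ φ) (l : List ι) :
    ContDiff ℝ ∞ (iterPartialDeriv l φ) := by
  induction l with
  | nil => exact hφ
  | cons i l ih => exact contDiff_partialDeriv ih i

theorem hasCompactSupport_iterPartialDeriv {φ : EuclideanSpace ℝ ι → ℝ}
    (hφ : HasCompactSupport φ) (l : List ι) : HasCompactSupport (iterPartialDeriv l φ) := by
  induction l with
  | nil => exact hφ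
  | cons i l ih => exact hasCompactSupport_partialDeriv ih i

theorem integral_mul_partialDeriv {f φ : EuclideanSpace ℝ ι → ℝ} (hf : ContDiff ℝ ∞ f)
    (hφ : ContDiff ℝ ∞ φ) (hφc : HasCompactSupport φ) (i : ι) :
    ∫ x, f x * partialDeriv i φ x = - ∫ x, partialDeriv i f x * φ x :=
  integral_mul_fderiv_eq_neg_fderiv_mul_of_integrable
    (((contDiff_partialDeriv hf i).continuous.mul hφ.continuous).integrable_of_hasCompactSupport
      hφc.mul_left)
    ((hf.continuous.mul (contDiff_partialDeriv hφ i).continuous).integrable_of_hasCompactSupport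
      (hasCompactSupport_partialDeriv hφc i).mul_left)
    ((hf.continuous.mul hφ.continuous).integrable_of_hasCompactSupport hφc.mul_left)
    (fun x _ => (hf.differentiable (by simp)) x) (fun x _ => (hφ.differentiable (by simp)) x)

theorem iterPartialDeriv_append (l k : List ι) (φ : EuclideanSpace ℝ ι → ℝ) :
    iterPartialDeriv (l ++ k) φ = iterPartialDeriv l (iterPartialDeriv k φ) := by
  induction l with
  | nil => rfl
  | cons i l ih => simp [iterPartialDeriv, ih]

/-- A smooth function has its classical derivatives as weak derivatives. -/
theorem hasWeakDeriv_of_contDiff {f : EuclideanSpace ℝ ι → ℝ} (hf : ContDiff ℝ ∞ f) (l : List ι) :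
    HasWeakDeriv l f (iterPartialDeriv l.reverse f) := by
  refine ⟨hf.continuous.locallyIntegrable,
    (contDiff_iterPartialDeriv hf _).continuous.locallyIntegrable, fun φ hφ hφc => ?_⟩
  induction l generalizing f with
  | nil => simp [iterPartialDeriv]
  | cons i l ih =>
    have h := integral_mul_partialDeriv hf (contDiff_iterPartialDeriv hφ l)
      (hasCompactSupport_iterPartialDeriv hφc l) i
    rw [List.reverse_cons, iterPartialDeriv_append, List.length_cons, pow_succ, mul_neg_one,
      neg_mul]
    change ∫ x, f x * partialDeriv i (iterPartialDeriv l φ) x = _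
    rw [h, ih (contDiff_partialDeriv hf i)]
    rfl

theorem HasWeakDeriv.ae_eq {l : List ι} {f f' g g' : EuclideanSpace ℝ ι → ℝ}
    (h : HasWeakDeriv l f g) (h' : HasWeakDeriv l f' g') (hff' : f =ᵐ[volume] f') :
    g =ᵐ[volume] g' := by
  refine ae_eq_of_integral_contDiff_smul_eq h.2.1 h'.2.1 fun φ hφ hφc => ?_
  have e : ∫ x, f x * iterPartialDeriv l φ x = ∫ x, f' x * iterPartialDeriv l φ x :=
    integral_congr_ae (hff'.mono fun x hx => by simp only [hx])
  rw [h.2.2 φ hφ hφc, h'.2.2 φ hφ hφc] at e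
  simpa [mul_comm] using mul_left_cancel₀ (pow_ne_zero _ (by norm_num)) e

theorem HasWeakDeriv.weakDeriv {l : List ι} {f g : EuclideanSpace ℝ ι → ℝ}
    (h : HasWeakDeriv l f g) : HasWeakDeriv l f (weakDeriv l f) := by
  have hex : ∃ g, HasWeakDeriv l f g := ⟨g, h⟩
  rw [DiffGame.weakDeriv, dif_pos hex]
  exact hex.choose_spec

theorem HasWeakDeriv.weakDeriv_ae_eq {l : List ι} {f g : EuclideanSpace ℝ ι → ℝ}
    (h : HasWeakDeriv l f g) : DiffGame.weakDeriv l f =ᵐ[volume] g :=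
  h.weakDeriv.ae_eq h .rfl

theorem HasWeakDeriv.add {l : List ι} {f f' g g' : EuclideanSpace ℝ ι → ℝ}
    (h : HasWeakDeriv l f g) (h' : HasWeakDeriv l f' g') : HasWeakDeriv l (f + f') (g + g') := by
  refine ⟨h.1.add h'.1, h.2.1.add h'.2.1, fun φ hφ hφc => ?_⟩
  have hs := contDiff_iterPartialDeriv hφ l
  have hc := hasCompactSupport_iterPartialDeriv hφc l
  simp only [Pi.add_apply, add_mul]
  rw [integral_add (integrable_mul_of_contDiff h.1 hs hc) (integrable_mul_of_contDiff h'.1 hs hc),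
    integral_add (integrable_mul_of_contDiff h.2.1 hφ hφc)
      (integrable_mul_of_contDiff h'.2.1 hφ hφc),
    h.2.2 φ hφ hφc, h'.2.2 φ hφ hφc, mul_add]

theorem hasWeakDeriv_zero (l : List ι) :
    HasWeakDeriv l (0 : EuclideanSpace ℝ ι → ℝ) 0 :=
  ⟨locallyIntegrable_zero, locallyIntegrable_zero, fun φ _ _ => by simp⟩

theorem MemSobolev.hasWeakDeriv_weakDeriv {k : ℕ} {f : EuclideanSpace ℝ ι → ℝ}
    (hf : MemSobolev k f) {l : List ι} (hl : l.length ≤ k) : HasWeakDeriv l f (weakDeriv l f) :=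
  (hf.2 l hl).choose_spec.1.weakDeriv

/-- Not definitional: the chosen weak derivative of 0 vanishes only almost everywhere. -/
theorem norm0_zero : norm0 (0 : EuclideanSpace ℝ ι → ℝ) = 0 := by
  have h : ∀ l : List ι, ∫ x, weakDeriv l (0 : EuclideanSpace ℝ ι → ℝ) x
      * weakDeriv l (0 : EuclideanSpace ℝ ι → ℝ) x = 0 := fun l => by
    refine integral_eq_zero_of_ae ((hasWeakDeriv_zero l).weakDeriv_ae_eq.mono fun x hx => ?_)
    simp [hx]
  simp [norm0, inner0, h]

theorem mem_C0_of_contDiff_of_hasCompactSupport {φ : EuclideanSpace ℝ ι → ℝ}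
    (hφ : ContDiff ℝ ∞ φ) (hφc : HasCompactSupport φ) : φ ∈ C0 ι := by
  have hmem : MemSobolev 2 φ := ⟨hφ.continuous.locallyIntegrable, fun l _ =>
    ⟨_, hasWeakDeriv_of_contDiff hφ l,
      (contDiff_iterPartialDeriv hφ _).continuous.memLp_of_hasCompactSupport
        (hasCompactSupport_iterPartialDeriv hφc _)⟩⟩
  exact ⟨hmem, fun ε hε => ⟨φ, hφ, hmem, by rwa [sub_self, norm0_zero]⟩⟩

/-- A field in the orthogonal complement of the gradients is orthogonal to the gradients of test
functions. -/
theorem integral_sum_mul_partialDeriv_eq_zero {V : EuclideanSpace ℝ ι → EuclideanSpace ℝ ι}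
    (hV : V ∈ imTildeD1Perp ι) {φ : EuclideanSpace ℝ ι → ℝ} (hφ : ContDiff ℝ ∞ φ)
    (hφc : HasCompactSupport φ) : ∑ i, ∫ x, partialDeriv i φ x * V x i = 0 := by
  rw [← hV.2 φ (mem_C0_of_contDiff_of_hasCompactSupport hφ hφc)]
  refine Finset.sum_congr rfl fun i _ => integral_congr_ae ?_
  filter_upwards [(hasWeakDeriv_of_contDiff hφ [i]).weakDeriv_ae_eq] with x hx
  simp [tildeD1, hx, iterPartialDeriv]

theorem trace_fderiv_eq_sum {X : EuclideanSpace ℝ ι → EuclideanSpace ℝ ι}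
    (hX : Differentiable ℝ X) (x : EuclideanSpace ℝ ι) :
    LinearMap.trace ℝ _ (fderiv ℝ X x : EuclideanSpace ℝ ι →ₗ[ℝ] EuclideanSpace ℝ ι)
      = ∑ i, partialDeriv i (fun y => X y i) x := by
  rw [LinearMap.trace_eq_matrix_trace ℝ (EuclideanSpace.basisFun ι ℝ).toBasis, Matrix.trace]
  refine Finset.sum_congr rfl fun i _ => ?_
  have h : HasFDerivAt (fun y => X y i)
      ((EuclideanSpace.proj i : EuclideanSpace ℝ ι →L[ℝ] ℝ).comp (fderiv ℝ X x)) x :=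
    (EuclideanSpace.proj i : EuclideanSpace ℝ ι →L[ℝ] ℝ).hasFDerivAt.comp x (hX x).hasFDerivAt
  rw [partialDeriv, h.fderiv]
  simp [LinearMap.toMatrix_apply]

/-- A smooth field which is weakly orthogonal to gradients of test functions is
divergence-free. -/
theorem trace_fderiv_eq_zero_of_integral_eq_zero
    {X : EuclideanSpace ℝ ι → EuclideanSpace ℝ ι} (hX : ContDiff ℝ ∞ X)
    (h : ∀ φ : EuclideanSpace ℝ ι → ℝ, ContDiff ℝ ∞ φ → HasCompactSupport φ →
      ∑ i, ∫ x, partialDeriv i φ x * X x i = 0) (x : EuclideanSpace ℝ ι) :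
    LinearMap.trace ℝ _ (fderiv ℝ X x : EuclideanSpace ℝ ι →ₗ[ℝ] EuclideanSpace ℝ ι) = 0 := by
  rw [trace_fderiv_eq_sum (hX.differentiable (by simp))]
  have hXi : ∀ i, ContDiff ℝ ∞ fun y => X y i := fun i =>
    (EuclideanSpace.proj i : EuclideanSpace ℝ ι →L[ℝ] ℝ).contDiff.comp hX
  set D : EuclideanSpace ℝ ι → ℝ := fun x => ∑ i, partialDeriv i (fun y => X y i) x
  have hD : Continuous D :=
    continuous_finsetSum _ fun i _ => (contDiff_partialDeriv (hXi i) i).continuous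
  have hae : D =ᵐ[volume] fun _ => 0 := by
    refine ae_eq_zero_of_integral_contDiff_smul_eq_zero hD.locallyIntegrable fun φ hφ hφc => ?_
    have hsum := h φ hφ hφc
    have e : ∀ i, ∫ x, partialDeriv i φ x * X x i
        = - ∫ x, partialDeriv i (fun y => X y i) x * φ x := fun i => by
      rw [← integral_mul_partialDeriv (hXi i) hφ hφc i]
      simp only [mul_comm]
    simp only [e, Finset.sum_neg_distrib, neg_eq_zero] at hsum
    rw [← integral_finsetSum] at hsum
    · simpa [D, Finset.mul_sum, mul_comm] using hsum
    · exact fun i _ => ((contDiff_partialDeriv (hXi i) i).continuous.mul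
        hφ.continuous).integrable_of_hasCompactSupport hφc.mul_left
  -- Continuity upgrades almost everywhere to everywhere.
  exact congrFun ((hD.ae_eq_iff_eq volume continuous_const).1 hae) x

end Weak

/-! ### Application to vector potential games -/

/-- Membership in `C0` supplies genuine weak derivatives, so additivity is not spoiled by the
default value 0. -/
theorem simGrad_add_ae_eq {M : ℕ} {d : Fin M → ℕ} {v w : Game d}
    (hv : ∀ m, v m ∈ C0 (Σ m : Fin M, Fin (d m))) (hw : w ∈ TildeN d) :
    simGrad (v + w) =ᵐ[volume] simGrad v := by
  have h : ∀ i : Σ m : Fin M, Fin (d m), weakDeriv [i] ((v + w) i.1)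
      =ᵐ[volume] weakDeriv [i] (v i.1) + weakDeriv [i] (w i.1) := fun i =>
    (((hv i.1).1.hasWeakDeriv_weakDeriv (by simp)).add
      ((hw.1 i.1).1.1.hasWeakDeriv_weakDeriv (by simp))).weakDeriv_ae_eq
  filter_upwards [ae_all_iff.2 h, hw.2] with x hx hwx
  ext i
  have : weakDeriv [i] (w i.1) x = 0 := congrArg (fun y : Strategy d => y i) hwx
  exact (hx i).trans (by rw [Pi.add_apply, this, add_zero]; rfl)

/-- Treats the zero game on the same footing: its utilities, hence their weak derivatives, vanish
almost everywhere. -/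
theorem integral_sum_mul_partialDeriv_eq_zero_of_mem_TildeV {M : ℕ} {d : Fin M → ℕ} {v : Game d}
    (hv : v ∈ TildeV d) {φ : Strategy d → ℝ} (hφ : ContDiff ℝ ∞ φ)
    (hφc : HasCompactSupport φ) : ∑ i, ∫ x, partialDeriv i φ x * simGrad v x i = 0 := by
  rcases hv.2 with hperp | hzero
  · exact integral_sum_mul_partialDeriv_eq_zero hperp.2 hφ hφc
  · refine Finset.sum_eq_zero fun i _ => integral_eq_zero_of_ae ?_
    filter_upwards [((hv.1 i.1).1.hasWeakDeriv_weakDeriv (l := [i]) (by simp)).ae_eq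
      (hasWeakDeriv_zero [i]) (hzero i.1)] with x hx
    simp [simGrad, hx]

end DiffGame

theorem mainTheorem4 {M : ℕ} (d : Fin M → ℕ) (u : DiffGame.Game d)
    (hu : DiffGame.IsVectorPotentialGame u)
    (X : DiffGame.Strategy d → DiffGame.Strategy d)
    (hX : ContDiff ℝ ∞ X) (hXu : X =ᵐ[volume] DiffGame.simGrad u)
    (Ω : Set (DiffGame.Strategy d)) (θ : ℝ → DiffGame.Strategy d → DiffGame.Strategy d)
    (hθ : DiffGame.IsForwardFlowOn X Ω θ) (hΩ : DiffGame.BoundedOrbits Ω θ) :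
    DiffGame.IsPoincareRecurrentOn Ω θ := by
  obtain ⟨v, hv, w, hw, rfl⟩ := hu
  refine DiffGame.exists_tendsto_flow_of_divergence_eq_zero volume hX
    (DiffGame.trace_fderiv_eq_zero_of_integral_eq_zero hX fun φ hφ hφc => ?_) hθ hΩ
  rw [← DiffGame.integral_sum_mul_partialDeriv_eq_zero_of_mem_TildeV hv hφ hφc]
  refine Finset.sum_congr rfl fun i _ => integral_congr_ae ?_
  filter_upwards [hXu.trans (DiffGame.simGrad_add_ae_eq hv.1 hw)] with x hx
  simp only [hx]
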